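/- A \emph{block} of a permutation $\pi$ of $\{1,\dots,n\}$ is a non-empty set of consecutive positions whose values under $\pi$ form a set of consecutive integers; $\pi$ is \emph{simple} if its only blocks are the singletons and $\{1,\dots,n\}$. A permutation is \emph{plus indecomposable} if it cannot be written as $12[\alpha,\beta]$, that is, as a permutation $\alpha$ of positive length on the smallest values followed by a permutation $\beta$ of positive length on the largest values. Let $s_n$ and $i_n$ be the numbers of simple and of plus indecomposable permutations of length $n$, and consider the formal power series $$F(x)=\sum_{k\ge 1}k!\,x^k,\qquad I(x)=\sum_{k\ge 1}i_k x^k,\qquad S(x)=\sum_{k\ge 4}s_k x^k .$$ Let $F^{\langle -1\rangle}$ be the compositional inverse of $F$ and $\mathrm{Com}_n$ the coefficient of $t^n$ in $F^{\langle -1\rangle}(t)$. Then $$S(t)=t-\frac{2t^2}{1+t}-F^{\langle -1\rangle}(t);$$ for all $n\ge 4$, $$s_n=-\mathrm{Com}_n+(-1)^{n+1}\cdot 2;$$ and $$I(x)=\frac{F(x)}{1+F(x)}.$$ -/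

import Mathlib

/-- A block of a permutation `σ` of `{0, …, n-1}`: a non-empty set of consecutive positions
whose values form a set of consecutive values. -/
def IsBlock {n : ℕ} (σ : Equiv.Perm (Fin n)) (B : Set (Fin n)) : Prop :=
  B.Nonempty ∧ B.OrdConnected ∧ (σ '' B).OrdConnected

/-- A permutation is simple if its only blocks are the singletons and the set of all positions. -/
def IsSimplePerm {n : ℕ} (σ : Equiv.Perm (Fin n)) : Prop :=
  ∀ B : Set (Fin n), IsBlock σ B → (∃ i, B = {i}) ∨ B = Set.univ

/-- The inflation `12[α, β]`: the first `a` positions are arranged as `α` on the `a` smallest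
values, the last `b` positions are arranged as `β` on the `b` largest values. -/
def inflate12 {a b : ℕ} (α : Equiv.Perm (Fin a)) (β : Equiv.Perm (Fin b)) :
    Equiv.Perm (Fin (a + b)) :=
  finSumFinEquiv.permCongr (Equiv.sumCongr α β)

/-- A permutation is plus indecomposable if it is not of the form `12[α, β]` with `α` and `β`
permutations of positive length. -/
def IsPlusIndecomposable {n : ℕ} (σ : Equiv.Perm (Fin n)) : Prop :=
  ¬ ∃ (a b : ℕ) (_ : 0 < a) (_ : 0 < b) (h : a + b = n)
      (α : Equiv.Perm (Fin a)) (β : Equiv.Perm (Fin b)),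
      σ = (finCongr h).permCongr (inflate12 α β)

/-- `s_n`, the number of simple permutations of length `n`. -/
noncomputable def numSimple (n : ℕ) : ℕ :=
  Nat.card {σ : Equiv.Perm (Fin n) // IsSimplePerm σ}

/-- `i_n`, the number of plus indecomposable permutations of length `n`. -/
noncomputable def numPlusIndecomposable (n : ℕ) : ℕ :=
  Nat.card {σ : Equiv.Perm (Fin n) // IsPlusIndecomposable σ}

/-- `F = ∑_{k ≥ 1} k! x^k`. -/
noncomputable def permSeries : PowerSeries ℚ :=
  PowerSeries.mk fun k => if 1 ≤ k then (k.factorial : ℚ) else 0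

/-- `I = ∑_{k ≥ 1} i_k x^k`. -/
noncomputable def plusIndecomposableSeries : PowerSeries ℚ :=
  PowerSeries.mk fun k => if 1 ≤ k then (numPlusIndecomposable k : ℚ) else 0

/-- `S = ∑_{k ≥ 4} s_k x^k`. -/
noncomputable def simpleSeries : PowerSeries ℚ :=
  PowerSeries.mk fun k => if 4 ≤ k then (numSimple k : ℚ) else 0

theorem constantCoeff_permSeries : PowerSeries.constantCoeff permSeries = 0 := by
  rw [← PowerSeries.coeff_zero_eq_constantCoeff_apply]
  simp [permSeries]

theorem isUnit_coeff_one_permSeries : IsUnit (PowerSeries.coeff 1 permSeries) := by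
  simp [permSeries]

/-- The compositional inverse of `F`. -/
noncomputable def permSeriesCompInv : PowerSeries ℚ :=
  permSeries.substInvOfIsUnit isUnit_coeff_one_permSeries

/-- `permSeriesCompInv` is a two-sided inverse of `F` under composition, with zero constant
term, and it is the only power series `G` with zero constant term such that `F ∘ G = X`. -/
theorem permSeriesCompInv_spec :
    PowerSeries.constantCoeff permSeriesCompInv = 0 ∧
    permSeries.subst permSeriesCompInv = (PowerSeries.X : PowerSeries ℚ) ∧
    permSeriesCompInv.subst permSeries = (PowerSeries.X : PowerSeries ℚ) ∧
    ∀ G : PowerSeries ℚ, PowerSeries.constantCoeff G = 0 →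
      permSeries.subst G = (PowerSeries.X : PowerSeries ℚ) → G = permSeriesCompInv := by
  have h0 := constantCoeff_permSeries
  have hl : permSeriesCompInv.subst permSeries = (PowerSeries.X : PowerSeries ℚ) :=
    PowerSeries.subst_substInvOfIsUnit_left _ h0 _
  refine ⟨by simp [permSeriesCompInv], PowerSeries.subst_substInvOfIsUnit_right _ h0 _, hl, ?_⟩
  intro G hG hFG
  have hG' : PowerSeries.HasSubst G := PowerSeries.HasSubst.of_constantCoeff_zero' hG
  have hF' : PowerSeries.HasSubst permSeries := PowerSeries.HasSubst.of_constantCoeff_zero' h0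
  have h := PowerSeries.subst_comp_subst_apply hF' hG' permSeriesCompInv
  rw [hl, hFG, PowerSeries.subst_X hG', PowerSeries.X_subst] at h
  exact h

/-- `Com_n`, the coefficient of `t^n` in the compositional inverse of `F`. -/
noncomputable def comtet (n : ℕ) : ℚ := PowerSeries.coeff n permSeriesCompInv

open Function

variable {n k : ℕ}

/-! Every permutation of length n ≥ 2 is exactly one of: sum decomposable, skew decomposable, or an
inflation of a simple permutation of length k ≥ 4 by k non-empty permutations, in a unique way. Two
proper blocks covering all positions force a decomposition (`isDecomposable_of_isBlock_of_cover`).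
So in the remaining case overlapping proper blocks have proper union, the maximal proper blocks
partition the positions, and the quotient is simple (`exists_isInflationOf`). Conversely, proper
blocks of such an inflation stay inside the fibres (`IsInflationOf.eq_of_mem_isBlock`), whence
uniqueness. The inflating permutations contribute F^k, so the third class is counted by S ∘ F
(`card_not_isDecomposable`).

Cutting a permutation at its first split gives I(1 + F) = F. Reversing values matches the first two
classes, each with n! - i_n members, so S ∘ F = 2I - F - X (`simpleSeries_subst_permSeries`).
Substituting the inverse of F turns F into X and I into X/(1 + X), and S = 2X/(1 + X) - X - F⁻¹ is
the stated formula. -/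

theorem exists_equiv_fin_lt_iff {α L : Type*} [Fintype α] [LinearOrder L] {m : ℕ}
    (hm : Fintype.card α = m) (f : α → L) (hf : Injective f) :
    ∃ e : α ≃ Fin m, ∀ x y, e x < e y ↔ f x < f y := by
  let _ : LinearOrder α := LinearOrder.lift' f hf
  exact ⟨(Fintype.orderIsoFinOfCardEq α hm).symm.toEquiv,
    fun x y => (Fintype.orderIsoFinOfCardEq α hm).symm.lt_iff_lt⟩

/-- The only order automorphism of `Fin m` is the identity. With `exists_equiv_fin_lt_iff` this is
standardisation: permutations are built and compared through the orders they induce. -/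
theorem equiv_fin_eq_of_lt_iff {α : Type*} {m : ℕ} (e e' : α ≃ Fin m)
    (h : ∀ x y, e x < e y ↔ e' x < e' y) : e = e' := by
  have hmono : StrictMono (e.symm.trans e') := fun i j hij => by
    have := h (e.symm i) (e.symm j)
    simp only [Equiv.apply_symm_apply] at this
    simpa using this.1 hij
  have key : ∀ i, (e.symm.trans e') i = i := by
    intro i
    have := Subsingleton.elim (StrictMono.orderIsoOfSurjective _ hmono
      (e.symm.trans e').surjective) (OrderIso.refl (Fin m))
    exact congrArg (fun o : Fin m ≃o Fin m => o i) this
  ext1 x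
  simpa using (key (e x)).symm


/-! ### Blocks -/

theorem isBlock_iff (σ : Equiv.Perm (Fin n)) (B : Set (Fin n)) :
    IsBlock σ B ↔ B.Nonempty ∧ (∀ a ∈ B, ∀ b ∈ B, ∀ x, a < x → x < b → x ∈ B) ∧
      ∀ a ∈ B, ∀ b ∈ B, ∀ x, σ a < σ x → σ x < σ b → x ∈ B := by
  unfold IsBlock
  refine and_congr_right fun _ => and_congr ?_ ?_
  · rw [Set.ordConnected_def]
    refine ⟨fun h a ha b hb x h1 h2 => h ha hb ⟨h1.le, h2.le⟩, fun h a ha b hb x hx => ?_⟩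
    rcases hx.1.eq_or_lt with rfl | h1
    · exact ha
    rcases hx.2.eq_or_lt with rfl | h2
    · exact hb
    exact h a ha b hb x h1 h2
  · rw [Set.ordConnected_def]
    constructor
    · intro h a ha b hb x h1 h2
      have := h (Set.mem_image_of_mem σ ha) (Set.mem_image_of_mem σ hb) ⟨h1.le, h2.le⟩
      simpa using this
    · rintro h _ ⟨a, ha, rfl⟩ _ ⟨b, hb, rfl⟩ y hy
      obtain ⟨x, rfl⟩ := σ.surjective y
      rcases hy.1.eq_or_lt with h1 | h1
      · exact ⟨a, ha, h1⟩
      rcases hy.2.eq_or_lt with h2 | h2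
      · exact ⟨b, hb, h2.symm⟩
      exact ⟨x, h a ha b hb x h1 h2, rfl⟩

/-- A common point `c` cuts any interval with ends in the union into two pieces, each lying in one
of the two blocks. -/
theorem IsBlock.union {σ : Equiv.Perm (Fin n)} {B C : Set (Fin n)} (hB : IsBlock σ B)
    (hC : IsBlock σ C) (h : (B ∩ C).Nonempty) : IsBlock σ (B ∪ C) := by
  rw [isBlock_iff] at *
  obtain ⟨c, hcB, hcC⟩ := h
  obtain ⟨-, hB1, hB2⟩ := hB
  obtain ⟨-, hC1, hC2⟩ := hC
  refine ⟨⟨c, Or.inl hcB⟩, ?_, ?_⟩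
  · intro a ha b hb x h1 h2
    rcases lt_trichotomy x c with h | rfl | h
    · exact ha.imp (fun ha => hB1 a ha c hcB x h1 h) (fun ha => hC1 a ha c hcC x h1 h)
    · exact Or.inl hcB
    · exact hb.imp (fun hb => hB1 c hcB b hb x h h2) (fun hb => hC1 c hcC b hb x h h2)
  · intro a ha b hb x h1 h2
    rcases lt_trichotomy (σ x) (σ c) with h | h | h
    · exact ha.imp (fun ha => hB2 a ha c hcB x h1 h) (fun ha => hC2 a ha c hcC x h1 h)
    · exact Or.inl (σ.injective h ▸ hcB)
    · exact hb.imp (fun hb => hB2 c hcB b hb x h h2) (fun hb => hC2 c hcC b hb x h h2)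

theorem isBlock_singleton (σ : Equiv.Perm (Fin n)) (x : Fin n) : IsBlock σ {x} := by
  simp [IsBlock, Set.ordConnected_singleton]

/-! ### Sum and skew decompositions -/

/-- The positions split into an initial and a final part such that the values of the initial part
are below those of the final part. -/
def IsSumDecomposable (σ : Equiv.Perm (Fin n)) : Prop :=
  ∃ P : Set (Fin n), P.Nonempty ∧ Pᶜ.Nonempty ∧ ∀ x ∈ P, ∀ y ∉ P, x < y ∧ σ x < σ y

/-- The positions split into an initial and a final part such that the values of the initial part
are above those of the final part. -/
def IsSkewDecomposable (σ : Equiv.Perm (Fin n)) : Prop :=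
  ∃ P : Set (Fin n), P.Nonempty ∧ Pᶜ.Nonempty ∧ ∀ x ∈ P, ∀ y ∉ P, x < y ∧ σ y < σ x

theorem exists_disjoint_blocks_of_isDecomposable {σ : Equiv.Perm (Fin n)}
    (h : IsSumDecomposable σ ∨ IsSkewDecomposable σ) :
    ∃ P : Set (Fin n), P ≠ Set.univ ∧ Pᶜ ≠ Set.univ ∧ IsBlock σ P ∧ IsBlock σ Pᶜ := by
  rcases h with ⟨P, hP, hP', h⟩ | ⟨P, hP, hP', h⟩
  all_goals
    refine ⟨P, Set.nonempty_compl.1 hP', Set.nonempty_compl.1 (by simpa using hP), ?_, ?_⟩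
  all_goals rw [isBlock_iff]
  · exact ⟨hP, fun a _ b hb x _ h2 => by_contra fun hx => lt_asymm h2 (h b hb x hx).1,
      fun a _ b hb x _ h2 => by_contra fun hx => lt_asymm h2 (h b hb x hx).2⟩
  · exact ⟨hP', fun a ha b _ x h1 _ hx => lt_asymm h1 (h x hx a ha).1,
      fun a ha b _ x h1 _ hx => lt_asymm h1 (h x hx a ha).2⟩
  · exact ⟨hP, fun a _ b hb x _ h2 => by_contra fun hx => lt_asymm h2 (h b hb x hx).1,
      fun a ha b _ x h1 _ => by_contra fun hx => lt_asymm h1 (h a ha x hx).2⟩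
  · exact ⟨hP', fun a ha b _ x h1 _ hx => lt_asymm h1 (h x hx a ha).1,
      fun a _ b hb x _ h2 hx => lt_asymm h2 (h x hx b hb).2⟩

/-- A permutation covered by two proper blocks is sum or skew decomposable. -/
theorem isDecomposable_of_isBlock_of_cover {σ : Equiv.Perm (Fin n)} {B C : Set (Fin n)}
    (hB : IsBlock σ B) (hC : IsBlock σ C) (hB' : B ≠ Set.univ) (hC' : C ≠ Set.univ)
    (h : B ∪ C = Set.univ) : IsSumDecomposable σ ∨ IsSkewDecomposable σ := by
  rw [isBlock_iff] at hB hC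
  obtain ⟨⟨b, hb⟩, hB1, hB2⟩ := hB
  obtain ⟨⟨c, hc⟩, hC1, hC2⟩ := hC
  have hcov : ∀ x, x ∈ B ∨ x ∈ C := fun x => (Set.ext_iff.1 h x).2 trivial
  obtain ⟨u, hu⟩ := (Set.ne_univ_iff_exists_notMem _).1 hB'
  obtain ⟨v, hv⟩ := (Set.ne_univ_iff_exists_notMem _).1 hC'
  have huC := (hcov u).resolve_left hu
  have hvB := (hcov v).resolve_right hv
  -- Every point outside `B` compares with every point of `B` as `u` does with `v`, so the
  -- complement lies on one side of `B`; `key2` says the same for values.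
  have key1 : ∀ x ∉ B, ∀ y ∈ B, x < y ↔ u < v := by
    intro x hx y hy
    have hxC := (hcov x).resolve_left hx
    have n1 : x ≠ y := fun e => hx (e ▸ hy)
    have n2 : u ≠ v := fun e => hu (e ▸ hvB)
    have n3 : x ≠ v := fun e => hx (e ▸ hvB)
    have a1 := hB1 y hy v hvB x
    have a2 := hB1 v hvB y hy x
    have a3 := hC1 u huC x hxC v
    have a4 := hC1 x hxC u huC v
    constructor
    · intro h1
      by_contra h2
      have h3 := lt_of_le_of_ne (not_lt.1 h2) n2.symm
      rcases lt_or_gt_of_ne n3 with h4 | h4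
      · exact hv (a4 h4 h3)
      · exact hx (a2 h4 h1)
    · intro h1
      by_contra h2
      have h3 := lt_of_le_of_ne (not_lt.1 h2) n1.symm
      rcases lt_or_gt_of_ne n3 with h4 | h4
      · exact hx (a1 h3 h4)
      · exact hv (a3 h1 h4)
  have key2 : ∀ x ∉ B, ∀ y ∈ B, σ x < σ y ↔ σ u < σ v := by
    intro x hx y hy
    have hxC := (hcov x).resolve_left hx
    have n1 : σ x ≠ σ y := fun e => hx (σ.injective e ▸ hy)
    have n2 : σ u ≠ σ v := fun e => hu (σ.injective e ▸ hvB)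
    have n3 : σ x ≠ σ v := fun e => hx (σ.injective e ▸ hvB)
    have a1 := hB2 y hy v hvB x
    have a2 := hB2 v hvB y hy x
    have a3 := hC2 u huC x hxC v
    have a4 := hC2 x hxC u huC v
    constructor
    · intro h1
      by_contra h2
      have h3 := lt_of_le_of_ne (not_lt.1 h2) n2.symm
      rcases lt_or_gt_of_ne n3 with h4 | h4
      · exact hv (a4 h4 h3)
      · exact hx (a2 h4 h1)
    · intro h1
      by_contra h2
      have h3 := lt_of_le_of_ne (not_lt.1 h2) n1.symm
      rcases lt_or_gt_of_ne n3 with h4 | h4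
      · exact hx (a1 h3 h4)
      · exact hv (a3 h1 h4)
  have n1 : ∀ x ∉ B, ∀ y ∈ B, x ≠ y := fun x hx y hy e => hx (e ▸ hy)
  have flip1 : ¬ u < v → ∀ x ∈ B, ∀ y ∉ B, x < y := fun h x hx y hy =>
    lt_of_le_of_ne (not_lt.1 (mt (key1 y hy x hx).1 h)) (n1 y hy x hx).symm
  have flip2 : ¬ σ u < σ v → ∀ x ∈ B, ∀ y ∉ B, σ x < σ y := fun h x hx y hy =>
    lt_of_le_of_ne (not_lt.1 (mt (key2 y hy x hx).1 h)) fun e => n1 y hy x hx (σ.injective e).symm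
  by_cases h1 : u < v <;> by_cases h2 : σ u < σ v
  · exact Or.inl ⟨Bᶜ, ⟨u, hu⟩, ⟨v, by simpa using hvB⟩, fun x hx y hy =>
      ⟨(key1 x hx y (not_not.1 hy)).2 h1, (key2 x hx y (not_not.1 hy)).2 h2⟩⟩
  · exact Or.inr ⟨Bᶜ, ⟨u, hu⟩, ⟨v, by simpa using hvB⟩, fun x hx y hy =>
      ⟨(key1 x hx y (not_not.1 hy)).2 h1, flip2 h2 y (not_not.1 hy) x hx⟩⟩
  · exact Or.inr ⟨B, ⟨v, hvB⟩, ⟨u, hu⟩, fun x hx y hy =>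
      ⟨flip1 h1 x hx y hy, (key2 y hy x hx).2 h2⟩⟩
  · exact Or.inl ⟨B, ⟨v, hvB⟩, ⟨u, hu⟩, fun x hx y hy =>
      ⟨flip1 h1 x hx y hy, flip2 h2 x hx y hy⟩⟩

/-! ### Inflations of simple permutations -/

/-- `σ` arises from `τ` by replacing each position `i` by the positions in `p ⁻¹' {i}`. -/
def IsInflationOf (p : Fin n → Fin k) (σ : Equiv.Perm (Fin n)) (τ : Equiv.Perm (Fin k)) : Prop :=
  ∀ x y, p x ≠ p y → (σ x < σ y ↔ τ (p x) < τ (p y))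

theorem IsInflationOf.unique {p : Fin n → Fin k} (hp : Surjective p) {σ : Equiv.Perm (Fin n)}
    {τ τ' : Equiv.Perm (Fin k)} (h : IsInflationOf p σ τ) (h' : IsInflationOf p σ τ') :
    τ = τ' := by
  refine equiv_fin_eq_of_lt_iff τ τ' fun i j => ?_
  obtain ⟨x, rfl⟩ := hp i
  obtain ⟨y, rfl⟩ := hp j
  by_cases e : p x = p y
  · simp [e]
  · rw [← h x y e, h' x y e]

theorem IsInflationOf.isBlock_image {p : Fin n → Fin k} (hp : Surjective p) (hm : Monotone p)
    {σ : Equiv.Perm (Fin n)} {τ : Equiv.Perm (Fin k)} (h : IsInflationOf p σ τ)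
    {B : Set (Fin n)} (hB : IsBlock σ B) : IsBlock τ (p '' B) := by
  rw [isBlock_iff] at *
  obtain ⟨hne, hB1, hB2⟩ := hB
  refine ⟨hne.image p, ?_, ?_⟩
  · rintro _ ⟨a, ha, rfl⟩ _ ⟨b, hb, rfl⟩ i h1 h2
    obtain ⟨x, rfl⟩ := hp i
    exact ⟨x, hB1 a ha b hb x (hm.reflect_lt h1) (hm.reflect_lt h2), rfl⟩
  · rintro _ ⟨a, ha, rfl⟩ _ ⟨b, hb, rfl⟩ i h1 h2
    obtain ⟨x, rfl⟩ := hp i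
    refine ⟨x, hB2 a ha b hb x ((h a x ?_).2 h1) ((h x b ?_).2 h2), rfl⟩
    · exact fun e => h1.ne (congrArg τ e)
    · exact fun e => h2.ne (congrArg τ e)

theorem IsInflationOf.isBlock_preimage {p : Fin n → Fin k} (hp : Surjective p) (hm : Monotone p)
    {σ : Equiv.Perm (Fin n)} {τ : Equiv.Perm (Fin k)} (h : IsInflationOf p σ τ)
    {C : Set (Fin k)} (hC : IsBlock τ C) : IsBlock σ (p ⁻¹' C) := by
  rw [isBlock_iff] at *
  obtain ⟨hne, hC1, hC2⟩ := hC
  refine ⟨hne.preimage hp, ?_, ?_⟩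
  · intro a ha b hb x h1 h2
    rcases (hm h1.le).eq_or_lt with e | e
    · exact (e ▸ ha : p x ∈ C)
    rcases (hm h2.le).eq_or_lt with e' | e'
    · exact (e' ▸ hb : p x ∈ C)
    exact hC1 _ ha _ hb _ e e'
  · intro a ha b hb x h1 h2
    by_cases e : p a = p x
    · exact (e ▸ ha : p x ∈ C)
    by_cases e' : p x = p b
    · exact (e' ▸ hb : p x ∈ C)
    exact hC2 _ ha _ hb _ ((h _ _ e).1 h1) ((h _ _ e').1 h2)

/-- A position that is extreme both in position and in value is the complement of a block. -/
theorem not_isSimplePerm_of_extreme (hk : 3 ≤ k) {τ : Equiv.Perm (Fin k)} {i : Fin k}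
    (h1 : (∀ j, i ≤ j) ∨ (∀ j, j ≤ i)) (h2 : (∀ j, τ i ≤ τ j) ∨ (∀ j, τ j ≤ τ i)) :
    ¬ IsSimplePerm τ := by
  intro hs
  -- A position other than `i` and `j` exists because `k ≥ 3`; hence `{i}ᶜ` is not a singleton.
  have h3 : ∀ j : Fin k, ∃ l, l ≠ i ∧ l ≠ j := by
    intro j
    have : ({i, j} : Finset (Fin k)).card < (Finset.univ : Finset (Fin k)).card := by
      simpa using lt_of_le_of_lt Finset.card_le_two hk
    obtain ⟨l, -, hl⟩ := Finset.exists_mem_notMem_of_card_lt_card this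
    exact ⟨l, by simpa using hl⟩
  obtain ⟨l, hl, -⟩ := h3 i
  have hb : IsBlock τ {i}ᶜ := by
    rw [isBlock_iff]
    refine ⟨⟨l, hl⟩, ?_, ?_⟩
    · rintro a - b - x h4 h5 rfl
      rcases h1 with h1 | h1
      · exact (h1 a).not_gt h4
      · exact (h1 b).not_gt h5
    · rintro a - b - x h4 h5 rfl
      rcases h2 with h2 | h2
      · exact (h2 a).not_gt h4
      · exact (h2 b).not_gt h5
  rcases hs _ hb with ⟨j, hj⟩ | hu
  · obtain ⟨l, h4, h5⟩ := h3 j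
    have : l ∈ ({i}ᶜ : Set (Fin k)) := h4
    rw [hj] at this
    exact h5 this
  · have : i ∈ ({i}ᶜ : Set (Fin k)) := hu ▸ Set.mem_univ i
    exact this rfl

/-- In an inflation of a simple permutation, the proper blocks lie within the inflated positions. -/
theorem IsInflationOf.eq_of_mem_isBlock (hk : 3 ≤ k) {p : Fin n → Fin k} (hp : Surjective p)
    (hm : Monotone p) {σ : Equiv.Perm (Fin n)} {τ : Equiv.Perm (Fin k)}
    (h : IsInflationOf p σ τ) (hτ : IsSimplePerm τ) {B : Set (Fin n)} (hB : IsBlock σ B)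
    (hB' : B ≠ Set.univ) {x y : Fin n} (hx : x ∈ B) (hy : y ∈ B) : p x = p y := by
  rcases hτ _ (h.isBlock_image hp hm hB) with ⟨i, hi⟩ | hu
  · have h1 : p x ∈ p '' B := ⟨x, hx, rfl⟩
    have h2 : p y ∈ p '' B := ⟨y, hy, rfl⟩
    rw [hi] at h1 h2
    exact h1.trans h2.symm
  exfalso
  obtain ⟨z, hz⟩ := (Set.ne_univ_iff_exists_notMem _).1 hB'
  rw [isBlock_iff] at hB
  obtain ⟨-, hB1, hB2⟩ := hB
  have hrep : ∀ j, ∃ b ∈ B, p b = j := fun j => by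
    have : j ∈ p '' B := hu ▸ Set.mem_univ j
    exact this
  -- Every fibre meets `B`, so if `p z` were not extreme, `z` would lie between two elements of `B`,
  -- in position or in value.
  refine not_isSimplePerm_of_extreme hk (i := p z) ?_ ?_ hτ
  · by_contra! hcon
    obtain ⟨⟨i, hi⟩, ⟨j, hj⟩⟩ := hcon
    obtain ⟨a, ha, rfl⟩ := hrep i
    obtain ⟨b, hb, rfl⟩ := hrep j
    exact hz (hB1 a ha b hb z (hm.reflect_lt hi) (hm.reflect_lt hj))
  · by_contra! hcon
    obtain ⟨⟨i, hi⟩, ⟨j, hj⟩⟩ := hcon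
    obtain ⟨a, ha, rfl⟩ := hrep i
    obtain ⟨b, hb, rfl⟩ := hrep j
    exact hz (hB2 a ha b hb z ((h _ _ fun e => hi.ne (congrArg τ e)).2 hi)
      ((h _ _ fun e => hj.ne (congrArg τ e)).2 hj))

/-- The left side involves only `σ`; hence `σ` determines the kernel of `p`, and so `k` and `p`. -/
theorem IsInflationOf.exists_isBlock_iff (hk : 3 ≤ k) {p : Fin n → Fin k} (hp : Surjective p)
    (hm : Monotone p) {σ : Equiv.Perm (Fin n)} {τ : Equiv.Perm (Fin k)}
    (h : IsInflationOf p σ τ) (hτ : IsSimplePerm τ) (x y : Fin n) :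
    (∃ B, IsBlock σ B ∧ B ≠ Set.univ ∧ x ∈ B ∧ y ∈ B) ↔ p x = p y := by
  refine ⟨fun ⟨B, h1, h2, h3, h4⟩ => h.eq_of_mem_isBlock hk hp hm hτ h1 h2 h3 h4, fun e => ?_⟩
  refine ⟨_, h.isBlock_preimage hp hm (isBlock_singleton τ (p x)), ?_, rfl, e.symm⟩
  intro hu
  have : Nontrivial (Fin k) := Fin.nontrivial_iff_two_le.2 (by omega)
  obtain ⟨j, hj⟩ := exists_ne (p x)
  obtain ⟨z, rfl⟩ := hp j
  have : z ∈ p ⁻¹' {p x} := hu ▸ Set.mem_univ z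
  exact hj this

/-- The two halves of a decomposition are proper blocks, so each lies in a single fibre; but there
are at least three fibres. -/
theorem IsInflationOf.not_isDecomposable (hk : 3 ≤ k) {p : Fin n → Fin k} (hp : Surjective p)
    (hm : Monotone p) {σ : Equiv.Perm (Fin n)} {τ : Equiv.Perm (Fin k)}
    (h : IsInflationOf p σ τ) (hτ : IsSimplePerm τ) :
    ¬ (IsSumDecomposable σ ∨ IsSkewDecomposable σ) := by
  intro hd
  obtain ⟨P, h1, h2, h3, h4⟩ := exists_disjoint_blocks_of_isDecomposable hd
  obtain ⟨a, ha⟩ := h3.1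
  obtain ⟨b, hb⟩ := h4.1
  have : ({p a, p b} : Finset (Fin k)).card < (Finset.univ : Finset (Fin k)).card := by
    simpa using lt_of_le_of_lt Finset.card_le_two hk
  obtain ⟨l, -, hl⟩ := Finset.exists_mem_notMem_of_card_lt_card this
  obtain ⟨z, rfl⟩ := hp l
  simp only [Finset.mem_insert, Finset.mem_singleton, not_or] at hl
  by_cases hz : z ∈ P
  · exact hl.1 (h.eq_of_mem_isBlock hk hp hm hτ h3 h1 hz ha)
  · exact hl.2 (h.eq_of_mem_isBlock hk hp hm hτ h4 h2 hz hb)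

/-! ### The simple quotient of an indecomposable permutation -/

/-- A monotone surjection onto an initial segment is determined by its kernel. -/
theorem eq_of_monotone_of_ker {k' : ℕ} {p : Fin n → Fin k} {p' : Fin n → Fin k'}
    (hp : Surjective p) (hm : Monotone p) (hp' : Surjective p') (hm' : Monotone p')
    (h : ∀ x y, p x = p y ↔ p' x = p' y) : ∃ e : k = k', ∀ x, finCongr e (p x) = p' x := by
  have hbij : Bijective fun i : Fin k => p' (surjInv hp i) := by
    constructor
    · intro i j hij
      have := (h _ _).2 hij
      simpa [surjInv_eq] using this
    · intro j
      obtain ⟨x, rfl⟩ := hp' j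
      exact ⟨p x, (h _ _).1 (surjInv_eq hp _)⟩
  have hk : k = k' := by simpa using Fintype.card_of_bijective hbij
  subst hk
  refine ⟨rfl, fun x => ?_⟩
  have key := equiv_fin_eq_of_lt_iff (Equiv.refl _) (Equiv.ofBijective _ hbij) fun i j => ?_
  · have := congrArg (fun e : Fin k ≃ Fin k => e (p x)) key
    simp only [Equiv.refl_apply, Equiv.ofBijective_apply] at this
    simpa using this.trans ((h _ _).1 (surjInv_eq hp _))
  · obtain ⟨x, rfl⟩ := hp i
    obtain ⟨y, rfl⟩ := hp j
    have hx : p' (surjInv hp (p x)) = p' x := (h _ _).1 (surjInv_eq hp _)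
    have hy : p' (surjInv hp (p y)) = p' y := (h _ _).1 (surjInv_eq hp _)
    simp only [Equiv.refl_apply, Equiv.ofBijective_apply, hx, hy]
    constructor
    · intro hl
      exact lt_of_le_of_ne (hm' (hm.reflect_lt hl).le) fun e => hl.ne ((h _ _).2 e)
    · intro hl
      exact lt_of_le_of_ne (hm (hm'.reflect_lt hl).le) fun e => hl.ne ((h _ _).1 e)

/-- A value outside a block lies below or above the whole block, so comparisons between disjoint
blocks do not depend on representatives. -/
theorem IsBlock.lt_iff {σ : Equiv.Perm (Fin n)} {B : Set (Fin n)} (hB : IsBlock σ B)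
    {a b x : Fin n} (ha : a ∈ B) (hb : b ∈ B) (hx : x ∉ B) : σ a < σ x ↔ σ b < σ x := by
  have key : ∀ a ∈ B, ∀ b ∈ B, σ a < σ x → σ b < σ x := fun a ha b hb h => by
    by_contra hc
    refine hx (((isBlock_iff σ B).1 hB).2.2 a ha b hb x h (lt_of_le_of_ne (not_lt.1 hc) ?_))
    exact fun e => hx (σ.injective e ▸ hb)
  exact ⟨key a ha b hb, key b hb a ha⟩

theorem IsBlock.gt_iff {σ : Equiv.Perm (Fin n)} {B : Set (Fin n)} (hB : IsBlock σ B)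
    {a b x : Fin n} (ha : a ∈ B) (hb : b ∈ B) (hx : x ∉ B) : σ x < σ a ↔ σ x < σ b := by
  have h : ∀ c ∈ B, σ x < σ c ↔ ¬ σ c < σ x := fun c hc =>
    ⟨lt_asymm, fun h => lt_of_le_of_ne (not_lt.1 h) fun e => hx (σ.injective e ▸ hc)⟩
  rw [h a ha, h b hb, hB.lt_iff ha hb hx]

/-- An equivalence relation with order-connected classes is the kernel of a monotone surjection. -/
theorem exists_monotone_surjective_ker (r : Setoid (Fin n))
    (hr : ∀ x y z, x ≤ y → y ≤ z → r x z → r x y) :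
    ∃ (k : ℕ) (p : Fin n → Fin k), Surjective p ∧ Monotone p ∧ ∀ x y, p x = p y ↔ r x y := by
  classical
  have hne : ∀ x, (Finset.univ.filter fun y => r y x).Nonempty := fun x => ⟨x, by simp⟩
  -- `q` sends a point to the least element of its class; numbering the values of `q` in order gives
  -- the surjection.
  let q : Fin n → Fin n := fun x => (Finset.univ.filter fun y => r y x).min' (hne x)
  have hq1 : ∀ x, r (q x) x := fun x => by
    have := Finset.min'_mem _ (hne x)
    simpa using this
  have hq2 : ∀ x y, r y x → q x ≤ y := fun x y h => Finset.min'_le _ _ (by simpa using h)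
  have hq3 : ∀ x y, r x y → q x = q y := fun x y h =>
    le_antisymm (hq2 _ _ (r.trans (hq1 y) (r.symm h))) (hq2 _ _ (r.trans (hq1 x) h))
  have hqm : Monotone q := fun x y h => by
    by_contra! hc
    have h1 : r (q y) x := hr _ _ _ (hc.le.trans (hq2 x x (r.refl x))) h (hq1 y)
    exact hc.ne' (hq3 _ _ (r.trans (r.symm h1) (hq1 y)))
  let s := Finset.univ.image q
  have hs : ∀ x, q x ∈ s := fun x => Finset.mem_image_of_mem q (Finset.mem_univ x)
  refine ⟨s.card, fun x => (s.orderIsoOfFin rfl).symm ⟨q x, hs x⟩, ?_, ?_, ?_⟩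
  · intro i
    obtain ⟨x, -, hx⟩ := Finset.mem_image.1 (s.orderIsoOfFin rfl i).2
    exact ⟨x, by rw [OrderIso.symm_apply_eq]; exact Subtype.ext hx⟩
  · intro x y h
    exact (s.orderIsoOfFin rfl).symm.monotone (hqm h)
  · intro x y
    rw [(s.orderIsoOfFin rfl).symm.injective.eq_iff, Subtype.mk.injEq]
    refine ⟨fun h => ?_, hq3 x y⟩
    have := hq1 x
    rw [h] at this
    exact r.trans (r.symm this) (hq1 y)

/-- Of the two end positions, at least one does not take the middle value. -/
theorem not_isSimplePerm_three (τ : Equiv.Perm (Fin 3)) : ¬ IsSimplePerm τ := by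
  have h : ∀ τ : Equiv.Perm (Fin 3), ∃ i : Fin 3, ((∀ j, i ≤ j) ∨ (∀ j, j ≤ i)) ∧
      ((∀ j, τ i ≤ τ j) ∨ (∀ j, τ j ≤ τ i)) := by decide
  obtain ⟨i, h1, h2⟩ := h τ
  exact not_isSimplePerm_of_extreme le_rfl h1 h2

/-- A permutation that is neither sum nor skew decomposable is an inflation of a simple one. -/
theorem exists_isInflationOf (hn : 2 ≤ n) {σ : Equiv.Perm (Fin n)}
    (hσ : ¬ (IsSumDecomposable σ ∨ IsSkewDecomposable σ)) :
    ∃ (k : ℕ) (p : Fin n → Fin k) (τ : Equiv.Perm (Fin k)), 4 ≤ k ∧ Surjective p ∧ Monotone p ∧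
      IsSimplePerm τ ∧ IsInflationOf p σ τ := by
  have hnt : Nontrivial (Fin n) := Fin.nontrivial_iff_two_le.2 hn
  have hunion : ∀ B C : Set (Fin n), IsBlock σ B → IsBlock σ C → B ≠ Set.univ → C ≠ Set.univ →
      (B ∩ C).Nonempty → IsBlock σ (B ∪ C) ∧ B ∪ C ≠ Set.univ := fun B C h1 h2 h3 h4 h5 =>
    ⟨h1.union h2 h5, fun h => hσ (isDecomposable_of_isBlock_of_cover h1 h2 h3 h4 h)⟩
  have hsing : ∀ x : Fin n, ({x} : Set (Fin n)) ≠ Set.univ := fun x h => by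
    obtain ⟨y, hy⟩ := exists_ne x
    have : y ∈ ({x} : Set (Fin n)) := h ▸ Set.mem_univ y
    exact hy this
  -- Transitivity of lying in a common proper block is `hunion`, which rests on indecomposability.
  let r : Setoid (Fin n) :=
    { r := fun x y => ∃ B, IsBlock σ B ∧ B ≠ Set.univ ∧ x ∈ B ∧ y ∈ B
      iseqv :=
        { refl := fun x => ⟨{x}, isBlock_singleton σ x, hsing x, rfl, rfl⟩
          symm := fun ⟨B, h1, h2, h3, h4⟩ => ⟨B, h1, h2, h4, h3⟩
          trans := fun {x y z} ⟨B, h1, h2, h3, h4⟩ ⟨C, h5, h6, h7, h8⟩ =>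
            ⟨B ∪ C, (hunion B C h1 h5 h2 h6 ⟨y, h4, h7⟩).1, (hunion B C h1 h5 h2 h6 ⟨y, h4, h7⟩).2,
              Or.inl h3, Or.inr h8⟩ } }
  have hmax : ∀ x, ∃ B, IsBlock σ B ∧ B ≠ Set.univ ∧ ∀ y, y ∈ B ↔ r x y := by
    intro x
    obtain ⟨B, ⟨h1, h2, h3⟩, hB⟩ := Set.Finite.exists_maximal
      (Set.toFinite {B : Set (Fin n) | IsBlock σ B ∧ B ≠ Set.univ ∧ x ∈ B})
      ⟨{x}, isBlock_singleton σ x, hsing x, rfl⟩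
    refine ⟨B, h1, h2, fun y => ⟨fun hy => ⟨B, h1, h2, h3, hy⟩, ?_⟩⟩
    rintro ⟨C, h4, h5, h6, h7⟩
    obtain ⟨h8, h9⟩ := hunion B C h1 h4 h2 h5 ⟨x, h3, h6⟩
    exact hB ⟨h8, h9, Or.inl h3⟩ Set.subset_union_left (Or.inr h7)
  obtain ⟨k, p, hp, hm, hker⟩ := exists_monotone_surjective_ker r fun x y z h1 h2 h => by
    obtain ⟨B, hB, hB', hx, hz⟩ := h
    exact ⟨B, hB, hB', hx, hB.2.1.out hx hz ⟨h1, h2⟩⟩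
  have hcls : ∀ x, ∃ B, IsBlock σ B ∧ B ≠ Set.univ ∧ ∀ y, y ∈ B ↔ p x = p y := fun x => by
    simpa only [hker] using hmax x
  -- `τ` is the pattern of `σ` on one representative of each class.
  obtain ⟨τ, hτ⟩ := exists_equiv_fin_lt_iff (Fintype.card_fin k) (fun i => σ (surjInv hp i))
    (σ.injective.comp (injective_surjInv hp))
  have hinfl : IsInflationOf p σ τ := by
    intro x y hxy
    rw [hτ]
    obtain ⟨B, hB, -, hBx⟩ := hcls x
    obtain ⟨C, hC, -, hCy⟩ := hcls y
    rw [hB.lt_iff (b := surjInv hp (p x)), hC.gt_iff (b := surjInv hp (p y))]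
    all_goals simp [hBx, hCy, surjInv_eq, hxy, Ne.symm hxy]
  have hsimple : IsSimplePerm τ := by
    intro C hC
    by_cases hu : p ⁻¹' C = Set.univ
    · right
      rw [Set.eq_univ_iff_forall] at hu ⊢
      intro i
      obtain ⟨x, rfl⟩ := hp i
      exact hu x
    · left
      obtain ⟨i, hi⟩ := hC.1
      refine ⟨i, Set.eq_singleton_iff_unique_mem.2 ⟨hi, fun j hj => ?_⟩⟩
      obtain ⟨x, rfl⟩ := hp i
      obtain ⟨y, rfl⟩ := hp j
      exact (hker _ _).2 ⟨_, hinfl.isBlock_preimage hp hm hC, hu, hj, hi⟩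
  refine ⟨k, p, τ, ?_, hp, hm, hsimple, hinfl⟩
  -- For k = 1 the only class would be a proper block, for k = 2 the two classes would cover `σ` and
  -- decompose it, and no permutation of length 3 is simple.
  by_contra! hk
  let x : Fin n := ⟨0, by omega⟩
  obtain ⟨B, hB, hB', hBx⟩ := hcls x
  obtain ⟨y, hy⟩ := (Set.ne_univ_iff_exists_notMem _).1 hB'
  rw [hBx] at hy
  obtain ⟨C, hC, hC', hCy⟩ := hcls y
  interval_cases k
  · exact (p x).elim0
  · exact hy (Subsingleton.elim _ _)
  · refine hσ (isDecomposable_of_isBlock_of_cover hB hC hB' hC' ?_)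
    rw [Set.eq_univ_iff_forall]
    intro z
    rw [Set.mem_union, hBx, hCy]
    generalize p x = a at *
    generalize p y = b at *
    generalize p z = c at *
    revert a b c
    clear * -
    omega
  · exact not_isSimplePerm_three τ hsimple

/-! ### Counting inflations by powers of F -/

/-- Replacing each position of `τ` by a permutation of `p ⁻¹' {i}`. -/
theorem card_isInflationOf (p : Fin n → Fin k) (τ : Equiv.Perm (Fin k)) :
    Nat.card {σ : Equiv.Perm (Fin n) // IsInflationOf p σ τ} =
      ∏ i, (Fintype.card {x // p x = i}).factorial := by
  classical
  have hres : ∀ (σ : Equiv.Perm (Fin n)) (i : Fin k),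
      ∃ e : {x // p x = i} ≃ Fin (Fintype.card {x // p x = i}),
        ∀ x y, e x < e y ↔ σ x.1 < σ y.1 := fun σ i =>
    exists_equiv_fin_lt_iff rfl (fun x : {x // p x = i} => σ x.1)
      (σ.injective.comp Subtype.val_injective)
  choose e he using hres
  have hbij : Bijective fun (σ : {σ : Equiv.Perm (Fin n) // IsInflationOf p σ τ}) (i : Fin k) =>
      e σ.1 i := by
    constructor
    · rintro ⟨σ, hσ⟩ ⟨σ', hσ'⟩ h
      refine Subtype.ext (equiv_fin_eq_of_lt_iff σ σ' fun x y => ?_)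
      by_cases hxy : p x = p y
      · have h1 := he σ (p y) ⟨x, hxy⟩ ⟨y, rfl⟩
        have h2 := he σ' (p y) ⟨x, hxy⟩ ⟨y, rfl⟩
        have h3 : e σ (p y) = e σ' (p y) := congrFun h (p y)
        rw [← h1, h3, h2]
      · rw [hσ x y hxy, hσ' x y hxy]
    · intro α
      -- The inverse map orders positions first by `τ` of their fibre, then by the prescribed
      -- pattern inside the fibre.
      let f : Fin n → Fin k ×ₗ ℕ := fun x => toLex (τ (p x), (α (p x) ⟨x, rfl⟩ : ℕ))
      have hα : ∀ i x (hx : p x = i), (α (p x) ⟨x, rfl⟩ : ℕ) = α i ⟨x, hx⟩ := by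
        rintro _ x rfl
        rfl
      have hf : Injective f := by
        intro x y h
        have h1 := Prod.ext_iff.1 (toLex.injective h)
        have h2 : p x = p y := τ.injective h1.1
        have h3 := h1.2
        simp only [hα (p y) x h2] at h3
        exact congrArg Subtype.val ((α (p y)).injective (Fin.ext h3))
      obtain ⟨σ, hσ⟩ := exists_equiv_fin_lt_iff (Fintype.card_fin n) f hf
      refine ⟨⟨σ, fun x y hxy => ?_⟩, funext fun i => equiv_fin_eq_of_lt_iff _ _ ?_⟩
      · simp [hσ, f, Prod.Lex.toLex_lt_toLex, hxy]
      · rintro ⟨x, hx⟩ ⟨y, hy⟩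
        rw [he, hσ]
        simp only [f, Prod.Lex.toLex_lt_toLex, hα i x hx, hα i y hy]
        simp [hx, hy]
  rw [Nat.card_congr (Equiv.ofBijective _ hbij), Nat.card_eq_fintype_card, Fintype.card_pi]
  exact Finset.prod_congr rfl fun i _ => by
    rw [Fintype.card_equiv (Fintype.equivFin _)]

/-- A monotone function is determined by the cardinalities of its fibres. -/
theorem Monotone.eq_of_card_fiber_eq {p p' : Fin n → Fin k} (hp : Monotone p) (hp' : Monotone p')
    (h : ∀ i, Fintype.card {x // p x = i} = Fintype.card {x // p' x = i}) : p = p' := by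
  let e : Equiv.Perm (Fin n) := (Equiv.sigmaFiberEquiv p').symm.trans
    ((Equiv.sigmaCongrRight fun i => Fintype.equivOfCardEq (h i).symm).trans
      (Equiv.sigmaFiberEquiv p))
  have he : p ∘ e = p' := by
    funext x
    exact (Fintype.equivOfCardEq (h (p' x)).symm ⟨x, rfl⟩).2
  have h1 : Monotone (p ∘ e) := he ▸ hp'
  have h2 : Monotone (p ∘ (1 : Equiv.Perm (Fin n))) := hp
  exact (Tuple.unique_monotone h2 h1).trans he

theorem exists_monotone_card_fiber_eq (l : Fin k → ℕ) (hl : ∑ i, l i = n) :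
    ∃ p : Fin n → Fin k, Monotone p ∧ ∀ i, Fintype.card {x // p x = i} = l i := by
  have E : (Σ i, Fin (l i)) ≃ Fin n := Fintype.equivOfCardEq (by simp [hl])
  let g : Fin n → Fin k := fun x => (E.symm x).1
  refine ⟨g ∘ Tuple.sort g, Tuple.monotone_sort g, fun i => ?_⟩
  rw [← Fintype.card_fin (l i)]
  refine Fintype.card_congr (((Tuple.sort g).trans E.symm).subtypeEquiv (fun x => ?_) |>.trans
    (Equiv.sigmaSubtype (β := fun i => Fin (l i)) i))
  rfl

/-- Expanding the power gives a sum over k-tuples of sizes with total n. Since F has no constant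
term, only positive sizes survive, and these are the fibre sizes of exactly one monotone surjection.
-/
theorem coeff_permSeries_pow (n k : ℕ) : PowerSeries.coeff n (permSeries ^ k) =
    ∑ p : {p : Fin n → Fin k // Surjective p ∧ Monotone p},
      ∏ i, ((Fintype.card {x // p.1 x = i}).factorial : ℚ) := by
  classical
  have h0 : permSeries ^ k = ∏ _i : Fin k, permSeries := by simp
  rw [h0, PowerSeries.coeff_prod]
  symm
  refine Finset.sum_of_injOn
    (fun p => Finsupp.equivFunOnFinite.symm fun i => Fintype.card {x // p.1 x = i}) ?_ ?_ ?_ ?_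
  · intro p _ p' _ h
    exact Subtype.ext (p.2.2.eq_of_card_fiber_eq p'.2.2
      (congrFun (Finsupp.equivFunOnFinite.symm.injective h)))
  · intro p _
    simp only [Finset.mem_coe, Finset.mem_finsuppAntidiag, Finset.subset_univ, and_true]
    have := Fintype.card_congr (Equiv.sigmaFiberEquiv p.1)
    simpa using this
  · intro l hl hl'
    by_contra hne
    have hpos : ∀ i, l i ≠ 0 := fun i hi =>
      hne (Finset.prod_eq_zero (Finset.mem_univ i) (by simp [hi, permSeries]))
    obtain ⟨p, hm, hp⟩ := exists_monotone_card_fiber_eq l (Finset.mem_finsuppAntidiag.1 hl).1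
    refine hl' ⟨⟨p, fun i => ?_, hm⟩, Finset.mem_coe.2 (Finset.mem_univ _), ?_⟩
    · have h1 : 0 < Fintype.card {x // p x = i} := by
        rw [hp]
        exact Nat.pos_of_ne_zero (hpos i)
      obtain ⟨⟨x, hx⟩⟩ := Fintype.card_pos_iff.1 h1
      exact ⟨x, hx⟩
    · ext i
      exact hp i
  · rintro ⟨p, hp, hm⟩ -
    refine Finset.prod_congr rfl fun i _ => ?_
    obtain ⟨x, hx⟩ := hp i
    have : 0 < Fintype.card {x // p x = i} := Fintype.card_pos_iff.2 ⟨⟨x, hx⟩⟩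
    simp only [permSeries, PowerSeries.coeff_mk, Finsupp.equivFunOnFinite_symm_apply_apply]
    exact (if_pos (show 1 ≤ _ from this)).symm

/-- X^k divides F^k, so the terms with k > n vanish. -/
theorem coeff_subst_permSeries (f : PowerSeries ℚ) (n : ℕ) :
    PowerSeries.coeff n (f.subst permSeries) =
      ∑ k : Fin (n + 1), PowerSeries.coeff k f * PowerSeries.coeff n (permSeries ^ (k : ℕ)) := by
  rw [PowerSeries.coeff_subst' (PowerSeries.HasSubst.of_constantCoeff_zero'
    constantCoeff_permSeries), finsum_eq_sum_of_support_subset (s := Finset.range (n + 1)),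
    Finset.sum_range]
  · simp
  · intro d hd
    by_contra hc
    refine hd ?_
    have hX : PowerSeries.X ^ d ∣ permSeries ^ d :=
      pow_dvd_pow_of_dvd (PowerSeries.X_dvd_iff.2 constantCoeff_permSeries) d
    have := PowerSeries.X_pow_dvd_iff.1 hX n (by simpa using hc)
    simp [this]

theorem card_not_isDecomposable (hn : 2 ≤ n) :
    (Nat.card {σ : Equiv.Perm (Fin n) // ¬ (IsSumDecomposable σ ∨ IsSkewDecomposable σ)} : ℚ) =
      PowerSeries.coeff n (simpleSeries.subst permSeries) := by
  classical
  let T := Σ k : Fin (n + 1), {p : Fin n → Fin k // Surjective p ∧ Monotone p} ×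
    {τ : Equiv.Perm (Fin k) // 4 ≤ (k : ℕ) ∧ IsSimplePerm τ}
  let f : (Σ t : T, {σ : Equiv.Perm (Fin n) // IsInflationOf t.2.1.1 σ t.2.2.1}) →
      {σ : Equiv.Perm (Fin n) // ¬ (IsSumDecomposable σ ∨ IsSkewDecomposable σ)} := fun t =>
    ⟨t.2.1, t.2.2.not_isDecomposable (le_trans (by norm_num) t.1.2.2.2.1) t.1.2.1.2.1
      t.1.2.1.2.2 t.1.2.2.2.2⟩
  have hf : Bijective f := by
    constructor
    · rintro ⟨⟨⟨k, hk⟩, ⟨p, hp, hm⟩, ⟨τ, h4, hτ⟩⟩, ⟨σ, hσ⟩⟩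
        ⟨⟨⟨k', hk'⟩, ⟨p', hp', hm'⟩, ⟨τ', h4', hτ'⟩⟩, ⟨σ', hσ'⟩⟩ h
      obtain rfl : σ = σ' := congrArg Subtype.val h
      dsimp only at p p' hp hp' hm hm' τ τ' h4 h4' hτ hτ' hσ hσ'
      -- Both kernels equal the relation of lying in a common proper block of `σ`.
      obtain ⟨rfl, hpp⟩ := eq_of_monotone_of_ker hp hm hp' hm' fun x y => by
        rw [← hσ.exists_isBlock_iff (by omega) hp hm hτ,
          ← hσ'.exists_isBlock_iff (by omega) hp' hm' hτ']
      obtain rfl : p = p' := funext hpp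
      obtain rfl := hσ.unique hp hσ'
      rfl
    · rintro ⟨σ, hσ⟩
      obtain ⟨k, p, τ, h4, hp, hm, hτ, hi⟩ := exists_isInflationOf hn hσ
      have hk : k < n + 1 := by
        have := Fintype.card_le_of_surjective p hp
        simp only [Fintype.card_fin] at this
        omega
      exact ⟨⟨⟨⟨k, hk⟩, ⟨p, hp, hm⟩, ⟨τ, h4, hτ⟩⟩, ⟨σ, hi⟩⟩, rfl⟩
  rw [← Nat.card_congr (Equiv.ofBijective f hf), Nat.card_sigma, coeff_subst_permSeries]
  simp only [card_isInflationOf]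
  rw [Fintype.sum_sigma]
  push_cast
  refine Finset.sum_congr rfl fun k _ => ?_
  rw [Fintype.sum_prod_type, coeff_permSeries_pow, Finset.mul_sum]
  refine Finset.sum_congr rfl fun p _ => ?_
  refine (Finset.sum_congr rfl fun y _ =>
    (rfl : _ = ∏ i, ((Fintype.card {x // p.1 x = i}).factorial : ℚ))).trans ?_
  rw [Finset.sum_const, nsmul_eq_mul, Finset.card_univ]
  congr 1
  simp only [simpleSeries, PowerSeries.coeff_mk, numSimple]
  split_ifs with h4
  · rw [← Nat.card_eq_fintype_card]
    congr 1
    exact Nat.card_congr (Equiv.subtypeEquivRight fun τ => by simp [h4])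
  · have : IsEmpty {τ : Equiv.Perm (Fin k) // 4 ≤ (k : ℕ) ∧ IsSimplePerm τ} := ⟨fun τ => h4 τ.2.1⟩
    simp

/-! ### The first split and plus indecomposable permutations -/

/-- The first `m` positions carry the `m` smallest values. -/
def SplitsAt (σ : Equiv.Perm (Fin n)) (m : ℕ) : Prop := ∀ x : Fin n, x.val < m → (σ x).val < m

/-- A permutation mapping a finite set into itself maps it onto itself. -/
theorem SplitsAt.lt_iff {σ : Equiv.Perm (Fin n)} {m : ℕ} (h : SplitsAt σ m) (x : Fin n) :
    (σ x).val < m ↔ x.val < m := by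
  refine ⟨fun hx => ?_, h x⟩
  simpa using Equiv.Perm.perm_symm_on_of_perm_on_finite (p := fun x : Fin n => x.val < m) h hx

theorem mem_iff_lt_card_of_forall_lt {P : Finset (Fin n)} (h : ∀ x ∈ P, ∀ y ∉ P, x < y)
    (x : Fin n) : x ∈ P ↔ x.val < P.card := by
  constructor
  · intro hx
    have : Finset.Iic x ⊆ P := fun y hy => by
      by_contra hc
      exact (Finset.mem_Iic.1 hy).not_gt (h x hx y hc)
    have := Finset.card_le_card this
    rw [Fin.card_Iic] at this
    omega
  · intro hx
    by_contra hc
    have : P ⊆ Finset.Iio x := fun y hy => Finset.mem_Iio.2 (h y hy x hc)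
    have := Finset.card_le_card this
    rw [Fin.card_Iio] at this
    omega

theorem isSumDecomposable_iff {σ : Equiv.Perm (Fin n)} :
    IsSumDecomposable σ ↔ ∃ m, 0 < m ∧ m < n ∧ SplitsAt σ m := by
  classical
  constructor
  · rintro ⟨P, ⟨a, ha⟩, ⟨b, hb⟩, h⟩
    have h1 := mem_iff_lt_card_of_forall_lt (P := P.toFinset)
      fun x hx y hy => (h x (by simpa using hx) y (by simpa using hy)).1
    have h2 := mem_iff_lt_card_of_forall_lt (P := P.toFinset.map σ.toEmbedding)
      fun x hx y hy => by
        obtain ⟨x, rfl⟩ := σ.surjective x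
        obtain ⟨y, rfl⟩ := σ.surjective y
        exact (h x (by simpa using hx) y (by simpa using hy)).2
    simp only [Finset.card_map] at h2
    refine ⟨P.toFinset.card, Finset.card_pos.2 ⟨a, by simpa using ha⟩, ?_, fun x hx => ?_⟩
    · have : ¬ b.val < P.toFinset.card := fun hc => hb (by simpa using (h1 b).2 hc)
      have := b.isLt
      omega
    · rw [← h2]
      simpa using (h1 x).2 hx
  · rintro ⟨m, h0, hmn, h⟩
    refine ⟨{x | x.val < m}, ⟨⟨0, by omega⟩, h0⟩, ⟨⟨m, hmn⟩, by simp⟩, fun x hx y hy => ?_⟩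
    have h1 := (h.lt_iff x).2 hx
    have h2 := mt (h.lt_iff y).1 hy
    simp only [Set.mem_ofPred_eq] at hx hy
    exact ⟨Fin.lt_def.2 (by omega), Fin.lt_def.2 (by omega)⟩

theorem inflate12_castAdd {a b : ℕ} (α : Equiv.Perm (Fin a)) (β : Equiv.Perm (Fin b)) (x : Fin a) :
    inflate12 α β (Fin.castAdd b x) = Fin.castAdd b (α x) := by
  simp [inflate12, Equiv.permCongr_apply]

theorem inflate12_injective {a b : ℕ} :
    Injective fun q : Equiv.Perm (Fin a) × Equiv.Perm (Fin b) => inflate12 q.1 q.2 :=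
  (Equiv.injective _).comp Equiv.Perm.sumCongrHom_injective

theorem splitsAt_iff_exists_inflate12 {a b : ℕ} {σ : Equiv.Perm (Fin (a + b))} :
    SplitsAt σ a ↔ ∃ α β, σ = inflate12 α β := by
  constructor
  · intro h
    obtain ⟨⟨α, β⟩, hq⟩ := Equiv.Perm.mem_sumCongrHom_range_of_perm_mapsTo_inl
      (σ := finSumFinEquiv.permCongr.symm σ) (by
        rintro _ ⟨x, rfl⟩
        have h1 := h (Fin.castAdd b x) (by simp)
        refine ⟨⟨σ (Fin.castAdd b x), h1⟩, ?_⟩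
        rw [← finSumFinEquiv.injective.eq_iff]
        simp)
    refine ⟨α, β, ?_⟩
    exact (Equiv.symm_apply_eq _).1 hq.symm
  · rintro ⟨α, β, rfl⟩ x hx
    have : x = Fin.castAdd b ⟨x, hx⟩ := rfl
    rw [this, inflate12_castAdd]
    simp

theorem splitsAt_inflate12_iff {a b m : ℕ} (hm : m ≤ a) (α : Equiv.Perm (Fin a))
    (β : Equiv.Perm (Fin b)) : SplitsAt (inflate12 α β) m ↔ SplitsAt α m := by
  constructor
  · intro h x hx
    simpa [inflate12_castAdd] using h (Fin.castAdd b x) (by simpa using hx)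
  · intro h x hx
    have : x = Fin.castAdd b ⟨x, by omega⟩ := rfl
    rw [this, inflate12_castAdd]
    simpa using h ⟨x, by omega⟩ hx

theorem isPlusIndecomposable_iff {σ : Equiv.Perm (Fin n)} :
    IsPlusIndecomposable σ ↔ ¬ IsSumDecomposable σ := by
  rw [isSumDecomposable_iff]
  refine not_congr ⟨?_, ?_⟩
  · rintro ⟨a, b, ha, hb, rfl, α, β, rfl⟩
    exact ⟨a, ha, by omega, splitsAt_iff_exists_inflate12.2 ⟨α, β, rfl⟩⟩
  · rintro ⟨m, h0, hm, h⟩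
    obtain ⟨b, rfl⟩ := Nat.exists_eq_add_of_lt hm
    obtain ⟨α, β, h⟩ := (splitsAt_iff_exists_inflate12 (a := m) (b := b + 1)).1 h
    exact ⟨m, b + 1, h0, by omega, rfl, α, β, h⟩

/-- `a` is the least positive number such that the first `a` positions carry the `a` smallest
values. -/
def IsFirstSplit (σ : Equiv.Perm (Fin n)) (a : ℕ) : Prop :=
  0 < a ∧ SplitsAt σ a ∧ ∀ m, 0 < m → m < a → ¬ SplitsAt σ m

/-- In 12[α, β] the split at `a` is the first exactly when α is plus indecomposable, while β is
arbitrary and may be empty. -/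
theorem card_isFirstSplit {a : ℕ} (b : ℕ) (ha : 0 < a) :
    Nat.card {σ : Equiv.Perm (Fin (a + b)) // IsFirstSplit σ a} =
      numPlusIndecomposable a * b.factorial := by
  have hind : ∀ (α : Equiv.Perm (Fin a)) (β : Equiv.Perm (Fin b)),
      IsPlusIndecomposable α ↔ IsFirstSplit (inflate12 α β) a := by
    intro α β
    rw [isPlusIndecomposable_iff, isSumDecomposable_iff]
    constructor
    · intro h
      exact ⟨ha, splitsAt_iff_exists_inflate12.2 ⟨α, β, rfl⟩, fun m h0 hm hs =>
        h ⟨m, h0, hm, (splitsAt_inflate12_iff hm.le α β).1 hs⟩⟩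
    · rintro ⟨-, -, h⟩ ⟨m, h0, hm, hs⟩
      exact h m h0 hm ((splitsAt_inflate12_iff hm.le α β).2 hs)
  let f : {α : Equiv.Perm (Fin a) // IsPlusIndecomposable α} × Equiv.Perm (Fin b) →
      {σ : Equiv.Perm (Fin (a + b)) // IsFirstSplit σ a} := fun q =>
    ⟨inflate12 q.1 q.2, (hind _ _).1 q.1.2⟩
  have hf : Bijective f := by
    constructor
    · rintro ⟨⟨α, hα⟩, β⟩ ⟨⟨α', hα'⟩, β'⟩ h
      have := inflate12_injective (a₁ := (α, β)) (a₂ := (α', β')) (congrArg Subtype.val h)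
      simp only [Prod.mk.injEq] at this
      obtain ⟨rfl, rfl⟩ := this
      rfl
    · rintro ⟨σ, hσ⟩
      obtain ⟨α, β, rfl⟩ := splitsAt_iff_exists_inflate12.1 hσ.2.1
      exact ⟨(⟨α, (hind α β).2 hσ⟩, β), rfl⟩
  rw [← Nat.card_congr (Equiv.ofBijective f hf), Nat.card_prod, Nat.card_perm, Nat.card_fin]
  rfl

theorem factorial_eq_sum_numPlusIndecomposable (hn : 0 < n) : n.factorial =
    ∑ q ∈ Finset.HasAntidiagonal.antidiagonal n,
      if 1 ≤ q.1 then numPlusIndecomposable q.1 * q.2.factorial else 0 := by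
  classical
  let f : (Σ a : Fin (n + 1), {σ : Equiv.Perm (Fin n) // IsFirstSplit σ a}) →
      Equiv.Perm (Fin n) := fun t => t.2.1
  have hf : Bijective f := by
    constructor
    · rintro ⟨a, σ, ha, hs, hl⟩ ⟨a', σ', ha', hs', hl'⟩ h
      obtain rfl : σ = σ' := h
      obtain rfl : a = a' := by
        rcases lt_trichotomy a a' with h | h | h
        · exact absurd hs (hl' _ ha h)
        · exact h
        · exact absurd hs' (hl _ ha' h)
      rfl
    · intro σ
      -- The trivial split at `n` always exists; it is the first one for indecomposable `σ`.
      have hex : ∃ m, 0 < m ∧ SplitsAt σ m := ⟨n, hn, fun x _ => (σ x).isLt⟩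
      refine ⟨⟨⟨Nat.find hex, ?_⟩, σ, (Nat.find_spec hex).1, (Nat.find_spec hex).2, ?_⟩, rfl⟩
      · exact Nat.lt_succ_of_le (Nat.find_min' hex ⟨hn, fun x _ => (σ x).isLt⟩)
      · exact fun m h0 hm hs => Nat.find_min hex hm ⟨h0, hs⟩
  have h1 := Nat.card_congr (Equiv.ofBijective f hf)
  rw [Nat.card_perm, Nat.card_fin, Nat.card_sigma] at h1
  rw [← h1, Finset.Nat.sum_antidiagonal_eq_sum_range_succ_mk, Finset.sum_range]
  refine Finset.sum_congr rfl fun a _ => ?_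
  obtain ⟨a, ha⟩ := a
  dsimp only
  split_ifs with h0
  · obtain ⟨b, rfl⟩ := Nat.exists_eq_add_of_le (Nat.lt_succ_iff.1 ha)
    rw [card_isFirstSplit b h0, Nat.add_sub_cancel_left]
  · have : IsEmpty {σ : Equiv.Perm (Fin n) // IsFirstSplit σ a} := ⟨fun σ => h0 σ.2.1⟩
    simp

theorem plusIndecomposableSeries_mul :
    plusIndecomposableSeries * (1 + permSeries) = permSeries := by
  ext n
  rw [PowerSeries.coeff_mul]
  -- The summand 1 supplies 0! = 1, which accounts for an empty second component.
  have hb : ∀ b, PowerSeries.coeff b (1 + permSeries) = (b.factorial : ℚ) := by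
    intro b
    rcases Nat.eq_zero_or_pos b with rfl | hb
    · simp [permSeries]
    · rw [map_add, PowerSeries.coeff_one, if_neg hb.ne', zero_add, permSeries,
        PowerSeries.coeff_mk, if_pos (show 1 ≤ b from hb)]
  rcases Nat.eq_zero_or_pos n with rfl | hn
  · simp [permSeries, plusIndecomposableSeries]
  · simp only [hb]
    rw [permSeries, PowerSeries.coeff_mk, if_pos (show 1 ≤ n from hn),
      factorial_eq_sum_numPlusIndecomposable hn]
    push_cast
    refine Finset.sum_congr rfl fun q _ => ?_
    simp [plusIndecomposableSeries]

/-! ### The three classes and the functional equation -/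

theorem card_isSumDecomposable_add (n : ℕ) :
    Nat.card {σ : Equiv.Perm (Fin n) // IsSumDecomposable σ} + numPlusIndecomposable n =
      n.factorial := by
  classical
  have h1 : numPlusIndecomposable n =
      Nat.card {σ : Equiv.Perm (Fin n) // ¬ IsSumDecomposable σ} :=
    Nat.card_congr (Equiv.subtypeEquivRight fun σ => isPlusIndecomposable_iff)
  rw [h1, ← Nat.card_sum, Nat.card_congr (Equiv.sumCompl _), Nat.card_perm, Nat.card_fin]

theorem card_isSkewDecomposable (n : ℕ) :
    Nat.card {σ : Equiv.Perm (Fin n) // IsSkewDecomposable σ} =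
      Nat.card {σ : Equiv.Perm (Fin n) // IsSumDecomposable σ} := by
  -- Left multiplication by `Fin.revPerm` reverses the values and keeps the positions.
  refine Nat.card_congr ((Equiv.mulLeft (Fin.revPerm (n := n))).subtypeEquiv fun σ => ?_)
  simp [IsSkewDecomposable, IsSumDecomposable]

/-- The two initial segments share a position, and so do the two final ones; the values at such a
pair would be ordered both ways. -/
theorem not_isSumDecomposable_and_isSkewDecomposable (σ : Equiv.Perm (Fin n)) :
    ¬ (IsSumDecomposable σ ∧ IsSkewDecomposable σ) := by
  rintro ⟨⟨P, ⟨a, ha⟩, ⟨b, hb⟩, hP⟩, ⟨Q, ⟨c, hc⟩, ⟨d, hd⟩, hQ⟩⟩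
  have h1 : ∃ x, x ∈ P ∧ x ∈ Q := by
    by_cases h : a ∈ Q
    · exact ⟨a, ha, h⟩
    · refine ⟨c, by_contra fun h' => ?_, hc⟩
      exact lt_asymm (hP a ha c h').1 (hQ c hc a h).1
  have h2 : ∃ y, y ∉ P ∧ y ∉ Q := by
    by_cases h : b ∈ Q
    · refine ⟨d, fun h' => ?_, hd⟩
      exact lt_asymm (hP d h' b hb).1 (hQ b h d hd).1
    · exact ⟨b, hb, h⟩
  obtain ⟨x, hx, hx'⟩ := h1
  obtain ⟨y, hy, hy'⟩ := h2
  exact lt_asymm (hP x hx y hy).2 (hQ x hx' y hy').2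

theorem card_not_isDecomposable_add (n : ℕ) :
    Nat.card {σ : Equiv.Perm (Fin n) // ¬ (IsSumDecomposable σ ∨ IsSkewDecomposable σ)} +
      n.factorial = 2 * numPlusIndecomposable n := by
  classical
  have h1 : Nat.card {σ : Equiv.Perm (Fin n) // IsSumDecomposable σ ∨ IsSkewDecomposable σ} =
      Nat.card {σ : Equiv.Perm (Fin n) // IsSumDecomposable σ} +
        Nat.card {σ : Equiv.Perm (Fin n) // IsSkewDecomposable σ} := by
    rw [← Nat.card_sum]
    refine Nat.card_congr (subtypeOrEquiv _ _ ?_)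
    rw [Pi.disjoint_iff]
    intro σ
    rw [Prop.disjoint_iff]
    exact not_isSumDecomposable_and_isSkewDecomposable σ
  have h2 := Nat.card_congr (Equiv.sumCompl fun σ : Equiv.Perm (Fin n) =>
    IsSumDecomposable σ ∨ IsSkewDecomposable σ)
  rw [Nat.card_sum, Nat.card_perm, Nat.card_fin] at h2
  have h3 := card_isSumDecomposable_add n
  have h4 := card_isSkewDecomposable n
  omega

theorem simpleSeries_subst_permSeries :
    simpleSeries.subst permSeries = 2 * plusIndecomposableSeries - permSeries - PowerSeries.X := by
  ext n
  have h2 : (2 : PowerSeries ℚ) = PowerSeries.C (2 : ℚ) := (map_ofNat _ 2).symm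
  simp only [map_sub, h2, PowerSeries.coeff_C_mul, PowerSeries.coeff_X]
  have hcard := card_not_isDecomposable_add n
  have hcard' : (Nat.card {σ : Equiv.Perm (Fin n) //
      ¬ (IsSumDecomposable σ ∨ IsSkewDecomposable σ)} : ℚ) + n.factorial =
        2 * numPlusIndecomposable n := by exact_mod_cast hcard
  -- The length-one permutation is indecomposable but absent from S ∘ F, which starts in degree 4;
  -- the term X corrects for it.
  rcases Nat.lt_or_ge n 2 with hn | hn
  · have h0 : PowerSeries.coeff n (simpleSeries.subst permSeries) = 0 := by
      rw [coeff_subst_permSeries]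
      refine Finset.sum_eq_zero fun k _ => ?_
      have : ¬ 4 ≤ (k : ℕ) := by omega
      simp [simpleSeries, this]
    rw [h0]
    interval_cases n
    · simp [permSeries, plusIndecomposableSeries]
    · have h1 : IsEmpty {σ : Equiv.Perm (Fin 1) // IsSumDecomposable σ} :=
        ⟨fun ⟨σ, h⟩ => by
          obtain ⟨m, h1, h2, -⟩ := isSumDecomposable_iff.1 h
          omega⟩
      have h3 := card_isSumDecomposable_add 1
      rw [Nat.card_of_isEmpty, zero_add] at h3
      simp [permSeries, plusIndecomposableSeries, h3]
      norm_num
  · rw [← card_not_isDecomposable hn, permSeries, plusIndecomposableSeries, PowerSeries.coeff_mk,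
      PowerSeries.coeff_mk, if_pos (by omega), if_pos (by omega), if_neg (by omega)]
    linarith

theorem one_add_X_inv_eq_mk :
    (1 + PowerSeries.X : PowerSeries ℚ)⁻¹ = PowerSeries.mk fun n => (-1) ^ n := by
  rw [eq_comm, PowerSeries.eq_inv_iff_mul_eq_one (by simp)]
  ext n
  rw [mul_add, mul_one, map_add]
  cases n with
  | zero => simp
  | succ n => simp [PowerSeries.coeff_succ_mul_X, pow_succ, PowerSeries.coeff_one]

/-- Composing with the inverse G of F sends the relation I(1 + F) = F to (I ∘ G)(1 + X) = X. -/
theorem simpleSeries_eq : simpleSeries =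
    PowerSeries.X - 2 * PowerSeries.X ^ 2 * (1 + PowerSeries.X)⁻¹ - permSeriesCompInv := by
  obtain ⟨h0, hFG, -, -⟩ := permSeriesCompInv_spec
  have hG : PowerSeries.HasSubst permSeriesCompInv := PowerSeries.HasSubst.of_constantCoeff_zero' h0
  have hF : PowerSeries.HasSubst permSeries :=
    PowerSeries.HasSubst.of_constantCoeff_zero' constantCoeff_permSeries
  have h1 := PowerSeries.subst_comp_subst_apply hF hG simpleSeries
  rw [hFG, PowerSeries.X_subst, simpleSeries_subst_permSeries] at h1
  have h2 := congrArg (PowerSeries.substAlgHom hG) plusIndecomposableSeries_mul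
  rw [← PowerSeries.coe_substAlgHom hG] at h1 hFG
  rw [map_mul, map_add, map_one, hFG] at h2
  rw [map_sub, map_sub, map_mul, map_ofNat, hFG, PowerSeries.substAlgHom_X] at h1
  have hinv : (1 + PowerSeries.X : PowerSeries ℚ) * (1 + PowerSeries.X)⁻¹ = 1 :=
    PowerSeries.mul_inv_cancel _ (by simp)
  rw [← h1]
  linear_combination (2 * (1 + PowerSeries.X : PowerSeries ℚ)⁻¹) * h2 +
    2 * (PowerSeries.X - PowerSeries.substAlgHom hG plusIndecomposableSeries) * hinv

theorem mainTheorem2 :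
    simpleSeries =
        PowerSeries.X - 2 * PowerSeries.X ^ 2 * (1 + PowerSeries.X)⁻¹ - permSeriesCompInv ∧
      (∀ n : ℕ, 4 ≤ n → (numSimple n : ℚ) = -comtet n + (-1) ^ (n + 1) * 2) ∧
      plusIndecomposableSeries = permSeries * (1 + permSeries)⁻¹ := by
  refine ⟨simpleSeries_eq, fun n hn => ?_, ?_⟩
  · obtain ⟨m, rfl⟩ := Nat.exists_eq_add_of_le' (show 2 ≤ n by omega)
    have h := congrArg (PowerSeries.coeff (m + 2)) simpleSeries_eq
    have h2 : (2 : PowerSeries ℚ) = PowerSeries.C (2 : ℚ) := (map_ofNat _ 2).symm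
    rw [map_sub, map_sub, one_add_X_inv_eq_mk, h2, mul_assoc, PowerSeries.coeff_C_mul,
      PowerSeries.coeff_X_pow_mul, PowerSeries.coeff_X, if_neg (by omega), simpleSeries,
      PowerSeries.coeff_mk, if_pos hn, PowerSeries.coeff_mk] at h
    rw [h, comtet]
    ring
  · rw [PowerSeries.eq_mul_inv_iff_mul_eq (by simp [constantCoeff_permSeries])]
    exact plusIndecomposableSeries_mul
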